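/- Let $0<\alpha<1$ and consider real-valued functions on $\mathbb{R}$ (identified when equal a.e.). For $\varphi\in C_0^\infty(\mathbb{R})$ let $${}^{-}D^{\alpha}\varphi(x)=\frac{1}{\Gamma(1-\alpha)}\frac{d}{dx}\int_{-\infty}^{x}\frac{\varphi(y)}{(x-y)^{\alpha}}\,dy,\qquad {}^{+}D^{\alpha}\varphi(x)=-\frac{1}{\Gamma(1-\alpha)}\frac{d}{dx}\int_{x}^{\infty}\frac{\varphi(y)}{(y-x)^{\alpha}}\,dy$$ be the left and right Riemann--Liouville derivatives. For $u\in L^2(\mathbb{R})$, a function $v\in L^1_{loc}(\mathbb{R})$ is the left (right) weak fractional derivative ${}^{-}\mathcal{D}^{\alpha}u$ (respectively ${}^{+}\mathcal{D}^{\alpha}u$) if $$\int_{\mathbb{R}} v\,\varphi\,dx=\int_{\mathbb{R}} u\;{}^{\pm}D^{\alpha}\varphi\,dx\qquad\forall\varphi\in C_0^\infty(\mathbb{R}),$$ with ${}^{+}D^\alpha$ on the right-hand side for the left derivative and ${}^{-}D^\alpha$ for the right derivative; it is unique up to a null set. Define - ${}^{\pm}H^{\alpha}(\mathbb{R})=\{u\in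 L^2(\mathbb{R}): {}^{\pm}\mathcal{D}^{\alpha}u \text{ exists and lies in } L^2(\mathbb{R})\}$, with norm $\big(\|u\|_{L^2}^2+\|{}^{\pm}\mathcal{D}^{\alpha}u\|_{L^2}^2\big)^{1/2}$; - $\widetilde H^{\alpha}(\mathbb{R})=\Big\{u\in L^2(\mathbb{R}): \frac{|u(x)-u(y)|}{|x-y|^{1/2+\alpha}}\in L^2(\mathbb{R}\times\mathbb{R})\Big\}$, with seminorm $[u]_{\widetilde H^\alpha}=\Big(\int_{\mathbb{R}}\int_{\mathbb{R}}\frac{|u(x)-u(y)|^2}{|x-y|^{1+2\alpha}}\,dx\,dy\Big)^{1/2}$ and norm $\big(\|u\|_{L^2}^2+[u]_{\widetilde H^\alpha}^2\big)^{1/2}$; - $\widehat H^{\alpha}(\mathbb{R})=\Big\{u\in L^2(\mathbb{R}): \int_{\mathbb{R}}(1+|\xi|^{2\alpha})|\hat u(\xi)|^2\,d\xi<\infty\Big\}$, with norm the square root of this integral, where $\hat u$ is the Fourier transform of $u\in L^2(\mathbb{R})$, normalized by $\hat u(\xi)=\int_{\mathbb{R}} e^{-2\pi i x\xi}u(x)\,dx$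 for integrable $u$. **Theorem.** For every $0<\alpha<1$, for both choices of the sign, $${}^{\pm}H^{\alpha}(\mathbb{R})=\widetilde H^{\alpha}(\mathbb{R})=\widehat H^{\alpha}(\mathbb{R})$$ as sets of functions, and there is a constant $C>0$ depending only on $\alpha$ such that on this common space any two of the four norms above bound each other up to the factor $C$. Moreover, with a constant of the same kind, $$C^{-1}[u]_{\widetilde H^\alpha}\le \|{}^{\pm}\mathcal{D}^{\alpha}u\|_{L^2(\mathbb{R})}\le C\,[u]_{\widetilde H^\alpha}\qquad\text{for all } u\in\widetilde H^{\alpha}(\mathbb{R}).$$ -/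

import Mathlib

noncomputable section

namespace FracSobolev

open MeasureTheory Set
open scoped ENNReal FourierTransform

/-- The real Hilbert space `L²(ℝ)` (classes of real-valued functions, Lebesgue measure). -/
abbrev L2 : Type := Lp ℝ 2 (volume : Measure ℝ)

/-- The two directions: `left` is the superscript `-`, `right` is the superscript `+`. -/
inductive Side : Type
  | left : Side
  | right : Side

/-- The opposite direction. -/
def Side.opp : Side → Side
  | .left => .right
  | .right => .left

/-- The classical (Riemann-Liouville) fractional derivative on `ℝ` of order `0 < α < 1`:
on the left `(1 / Γ(1-α)) d/dx ∫_{-∞}^x φ(y) (x-y)^{-α} dy`,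
on the right `-(1 / Γ(1-α)) d/dx ∫_x^∞ φ(y) (y-x)^{-α} dy`. -/
def classicalDeriv (α : ℝ) (φ : ℝ → ℝ) : Side → ℝ → ℝ
  | .left, x =>
      (Real.Gamma (1 - α))⁻¹ * deriv (fun z : ℝ => ∫ y in Iio z, φ y * (z - y) ^ (-α)) x
  | .right, x =>
      -((Real.Gamma (1 - α))⁻¹ * deriv (fun z : ℝ => ∫ y in Ioi z, φ y * (y - z) ^ (-α)) x)

/-- `φ ∈ C₀^∞(ℝ)`. -/
def IsTestFunction (φ : ℝ → ℝ) : Prop :=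
  ContDiff ℝ (⊤ : ℕ∞) φ ∧ HasCompactSupport φ

/-- `v ∈ L¹_loc(ℝ)` is the weak fractional derivative of `u` in direction `s`, of order
`0 < α < 1`: its action on a test function is that of `u` on the classical derivative of the
test function in the opposite direction. -/
def IsWeakFracDeriv (s : Side) (α : ℝ) (u v : ℝ → ℝ) : Prop :=
  LocallyIntegrable v ∧
    ∀ φ : ℝ → ℝ, IsTestFunction φ →
      ∫ x, v x * φ x = ∫ x, u x * classicalDeriv α φ s.opp x

/-- Weak fractional derivatives are unique up to a null set. -/
theorem IsWeakFracDeriv.ae_eq {s : Side} {α : ℝ} {u v w : ℝ → ℝ}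
    (hv : IsWeakFracDeriv s α u v) (hw : IsWeakFracDeriv s α u w) :
    ∀ᵐ x, v x = w x := by
  refine ae_eq_of_integral_contDiff_smul_eq hv.1 hw.1 fun g hg hc => ?_
  have h := (hv.2 g ⟨hg, hc⟩).trans (hw.2 g ⟨hg, hc⟩).symm
  simpa [mul_comm] using h

open Classical in
/-- The weak fractional derivative of `u`; the value `0` if there is none is never used. -/
def weakFracDeriv (s : Side) (α : ℝ) (u : ℝ → ℝ) : ℝ → ℝ :=
  if h : ∃ v, IsWeakFracDeriv s α u v then h.choose else 0

/-- The one-sided space `^±H^α(ℝ)`, `0 < α < 1`: the `u ∈ L²(ℝ)` that have a weak fractional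
derivative in direction `s`, and whose weak fractional derivative is in `L²(ℝ)`. -/
def oneSidedH (s : Side) (α : ℝ) : Set L2 :=
  {u | ∃ v : ℝ → ℝ, IsWeakFracDeriv s α u v ∧ MemLp v 2}

/-- The `L²` norm of the weak fractional derivative. -/
def oneSidedSeminorm (s : Side) (α : ℝ) (u : L2) : ℝ≥0∞ :=
  eLpNorm (weakFracDeriv s α u) 2 volume

/-- The norm of `^±H^α(ℝ)`. -/
def oneSidedNorm (s : Side) (α : ℝ) (u : L2) : ℝ≥0∞ :=
  (eLpNorm u 2 volume ^ 2 + oneSidedSeminorm s α u ^ 2) ^ (1 / 2 : ℝ)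

/-- The Gagliardo space `H̃^α(ℝ)`, `0 < α < 1`. -/
def gagliardoH (α : ℝ) : Set L2 :=
  {u | MemLp (fun z : ℝ × ℝ => |u z.1 - u z.2| / |z.1 - z.2| ^ (1 / 2 + α)) 2}

/-- The Gagliardo seminorm. -/
def gagliardoSeminorm (α : ℝ) (u : L2) : ℝ≥0∞ :=
  (∫⁻ x : ℝ, ∫⁻ y : ℝ, ENNReal.ofReal (|u x - u y| ^ 2 / |x - y| ^ (1 + 2 * α))) ^ (1 / 2 : ℝ)

/-- The norm of `H̃^α(ℝ)`. -/
def gagliardoNorm (α : ℝ) (u : L2) : ℝ≥0∞ :=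
  (eLpNorm u 2 volume ^ 2 + gagliardoSeminorm α u ^ 2) ^ (1 / 2 : ℝ)

/-- The Fourier(-Plancherel) transform of a real-valued `u ∈ L²(ℝ)`. -/
def hat (u : L2) : Lp ℂ 2 (volume : Measure ℝ) :=
  𝓕 (Complex.ofRealCLM.compLp u : Lp ℂ 2 (volume : Measure ℝ))

/-- The norm of `Ĥ^α(ℝ)`: the square root of `∫ (1 + |ξ|^{2α}) |û(ξ)|² dξ`. -/
def fourierNorm (α : ℝ) (u : L2) : ℝ≥0∞ :=
  (∫⁻ ξ : ℝ, ENNReal.ofReal ((1 + |ξ| ^ (2 * α)) * ‖hat u ξ‖ ^ 2)) ^ (1 / 2 : ℝ)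

/-- The Fourier space `Ĥ^α(ℝ)`. -/
def fourierH (α : ℝ) : Set L2 :=
  {u | (∫⁻ ξ : ℝ, ENNReal.ofReal ((1 + |ξ| ^ (2 * α)) * ‖hat u ξ‖ ^ 2)) < ∞}

/-- Two extended-real-valued (semi)norms are equivalent on the set `X`. -/
def EquivOn (X : Set L2) (N₁ N₂ : L2 → ℝ≥0∞) : Prop :=
  ∃ C : ℝ, 0 < C ∧ ∀ u ∈ X, N₁ u ≤ ENNReal.ofReal C * N₂ u ∧ N₂ u ≤ ENNReal.ofReal C * N₁ u

end FracSobolev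

end

noncomputable section

namespace FracSobolev

open MeasureTheory Set Filter Topology
open scoped ENNReal FourierTransform SchwartzMap ContDiff ComplexConjugate

/-! Everything is measured by one quantity, the energy `E(u) = ∫ |ξ|^{2α} |û(ξ)|² dξ`: each space is
`{u ∈ L² : E(u) < ∞}`, each squared seminorm is a positive finite multiple of `E(u)`, and the full
norms add the same `‖u‖²`. Set equality and equivalence of norms are then comparisons of constants.

For the Gagliardo seminorm, put `y = x + h` and apply Plancherel in `x` for fixed `h`: a translation
becomes the factor `e^{2πihξ}`. Integrating `|e^{2πihξ} - 1|² / |h|^{1+2α}` over `h` and rescaling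
by `ξ` leaves a constant times `|ξ|^{2α}` (`gagliardoSeminorm_sq`).

For the one-sided derivatives, the Laplace transform of a power, continued to complex frequencies
and taken to the imaginary axis, shows that the classical derivative of a test function is the
Fourier multiplier `(±2πiξ)^α` (`classicalDeriv_eq_fourierInv`). By Parseval, an `L²` weak
derivative of `u` must have as its transform `û` times the conjugate of the opposite multiplier
(`IsWeakFracDeriv.hat_eq`). Conversely, finite energy lets that product be inverted into a weak
derivative (`exists_isWeakFracDeriv`). Only the modulus `(2π|ξ|)^α` enters the norms, so both
directions give the same constant. -/

/-! ### Fourier-Plancherel transform by duality with Schwartz functions. -/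

/-- Locally integrable functions with the same pairings against compactly supported Schwartz
functions agree. -/
theorem ae_eq_of_forall_schwartz {f g : ℝ → ℂ} (hf : LocallyIntegrable f) (hg : LocallyIntegrable g)
    (h : ∀ ψ : 𝓢(ℝ, ℂ), HasCompactSupport ψ → ∫ x, ψ x * f x = ∫ x, ψ x * g x) : f =ᵐ[volume] g := by
  refine ae_eq_of_integral_contDiff_smul_eq hf hg fun φ hφ hc => ?_
  have hc' : HasCompactSupport (Complex.ofRealCLM ∘ φ) := hc.comp_left rfl
  have hφ' : ContDiff ℝ ∞ (Complex.ofRealCLM ∘ φ) := Complex.ofRealCLM.contDiff.comp hφ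
  simpa using h (hc'.toSchwartzMap hφ') hc'

theorem integral_fourier_lp (U : Lp ℂ 2 (volume : Measure ℝ)) (ψ : 𝓢(ℝ, ℂ)) :
    ∫ x, ψ x * (𝓕 U : Lp ℂ 2 (volume : Measure ℝ)) x = ∫ x, 𝓕 (ψ : ℝ → ℂ) x * U x := by
  have h := congrArg (fun T => T ψ) (Lp.fourier_toTemperedDistribution_eq U)
  simpa [Lp.toTemperedDistribution_apply, SchwartzMap.fourier_coe] using h.symm

theorem integral_fourierInv_lp (U : Lp ℂ 2 (volume : Measure ℝ)) (ψ : 𝓢(ℝ, ℂ)) :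
    ∫ x, ψ x * (𝓕⁻ U : Lp ℂ 2 (volume : Measure ℝ)) x = ∫ x, 𝓕⁻ (ψ : ℝ → ℂ) x * U x := by
  have h := congrArg (fun T => T ψ) (Lp.fourierInv_toTemperedDistribution_eq U)
  simpa [Lp.toTemperedDistribution_apply, SchwartzMap.fourierInv_coe] using h.symm

theorem locallyIntegrable_lp (U : Lp ℂ 2 (volume : Measure ℝ)) : LocallyIntegrable U :=
  (Lp.memLp U).locallyIntegrable (by norm_num)

theorem integral_mul_fourier_eq (f g : ℝ → ℂ) (hf : Integrable f) (hg : Integrable g) :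
    ∫ x, 𝓕 f x * g x = ∫ x, f x * 𝓕 g x := by
  have h := VectorFourier.integral_fourierIntegral_smul_eq_flip (L := innerₗ ℝ)
    Real.continuous_fourierChar continuous_inner hf hg
  rw [flip_innerₗ] at h
  exact h

theorem continuous_fourier {f : ℝ → ℂ} (hf : Integrable f) : Continuous (𝓕 f) :=
  VectorFourier.fourierIntegral_continuous Real.continuous_fourierChar
    (by exact continuous_inner) hf

theorem continuous_fourierInv {f : ℝ → ℂ} (hf : Integrable f) : Continuous (𝓕⁻ f) := by
  rw [Real.fourierInv_eq_fourier_comp_neg]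
  exact continuous_fourier hf.comp_neg

theorem integral_mul_fourierInv_eq (f g : ℝ → ℂ) (hf : Integrable f) (hg : Integrable g) :
    ∫ x, 𝓕⁻ f x * g x = ∫ x, f x * 𝓕⁻ g x := by
  rw [Real.fourierInv_eq_fourier_comp_neg, integral_mul_fourier_eq _ _ hf.comp_neg hg,
    ← integral_neg_eq_self]
  simp [Real.fourierInv_eq_fourier_neg]

/-- On `L¹ ∩ L²` the inverse Fourier-Plancherel transform is given by the integral. -/
theorem coeFn_fourierInv_toLp {g : ℝ → ℂ} (h1 : Integrable g) (h2 : MemLp g 2) :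
    (𝓕⁻ (h2.toLp g) : Lp ℂ 2 (volume : Measure ℝ)) =ᵐ[volume] 𝓕⁻ g := by
  refine ae_eq_of_forall_schwartz (locallyIntegrable_lp _)
    (continuous_fourierInv h1).locallyIntegrable fun ψ _ => ?_
  rw [integral_fourierInv_lp, ← integral_mul_fourierInv_eq _ _ ψ.integrable h1]
  refine integral_congr_ae ?_
  filter_upwards [h2.coeFn_toLp] with x hx using by rw [hx]

/-- The Fourier transform is injective on `L¹`. -/
theorem ae_eq_zero_of_fourier_eq_zero {g : ℝ → ℂ} (hg : Integrable g) (h : ∀ a, 𝓕 g a = 0) :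
    g =ᵐ[volume] 0 := by
  refine ae_eq_of_forall_schwartz hg.locallyIntegrable locallyIntegrable_zero fun ψ _ => ?_
  -- Write `ψ` as the transform of `𝓕⁻ ψ` and move that transform onto `g`.
  have h1 := integral_mul_fourier_eq (𝓕⁻ ψ : 𝓢(ℝ, ℂ)) g (𝓕⁻ ψ : 𝓢(ℝ, ℂ)).integrable hg
  rw [← SchwartzMap.fourier_coe, FourierTransform.fourier_fourierInv_eq] at h1
  simpa [h] using h1

/-- The Fourier transform of a translate. -/
theorem fourier_lp_translate {U W : Lp ℂ 2 (volume : Measure ℝ)} {a : ℝ}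
    (h : ∀ᵐ x, W x = U (x + a)) :
    ∀ᵐ ξ, (𝓕 W : Lp ℂ 2 (volume : Measure ℝ)) ξ =
      Real.fourierChar (a * ξ) * (𝓕 U : Lp ℂ 2 (volume : Measure ℝ)) ξ := by
  have hc : ContDiff ℝ ∞ fun ξ : ℝ => (Real.fourierChar (a * ξ) : ℂ) := by
    simp only [Real.fourierChar_apply]
    have h0 : ContDiff ℝ ∞ fun ξ : ℝ => 2 * Real.pi * (a * ξ) := by fun_prop
    exact ((Complex.ofRealCLM.contDiff.comp h0).mul contDiff_const).cexp
  refine ae_eq_of_forall_schwartz (locallyIntegrable_lp _) ?_ fun ψ hψ => ?_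
  · exact (locallyIntegrable_lp _).continuous_smul hc.continuous
  -- Compact support of `ψ` makes its product with the character a Schwartz function with no
  -- derivative estimates; the transform of the product is `𝓕 ψ` translated by `a`.
  · have hs : HasCompactSupport fun ξ : ℝ => (Real.fourierChar (a * ξ) : ℂ) * ψ ξ :=
      hψ.mul_left
    have h3 := integral_fourier_lp U (hs.toSchwartzMap (hc.mul (ψ.smooth _)))
    rw [integral_fourier_lp]
    trans ∫ x, 𝓕 (ψ : ℝ → ℂ) (x - a) * U x
    · rw [← integral_add_right_eq_self (fun x => 𝓕 (ψ : ℝ → ℂ) (x - a) * U x) a]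
      refine integral_congr_ae ?_
      filter_upwards [h] with x hx
      rw [hx, add_sub_cancel_right]
    · convert h3.symm using 1
      · refine integral_congr_ae (.of_forall fun x => ?_)
        simp only
        congr 1
        rw [Real.fourier_eq, Real.fourier_eq]
        refine integral_congr_ae (.of_forall fun y => ?_)
        simp [Circle.smul_def, Real.fourierChar_apply, ← mul_assoc, ← Complex.exp_add]
        left
        congr 1
        ring
      · refine integral_congr_ae (.of_forall fun x => ?_)
        simp
        ring

theorem lintegral_enorm_sq_lp (U : Lp ℂ 2 (volume : Measure ℝ)) :
    ∫⁻ ξ, ‖(𝓕 U : Lp ℂ 2 (volume : Measure ℝ)) ξ‖ₑ ^ 2 = ∫⁻ x, ‖U x‖ₑ ^ 2 := by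
  have h := Lp.norm_fourier_eq U
  have key : ∀ V : Lp ℂ 2 (volume : Measure ℝ), ∫⁻ ξ, ‖V ξ‖ₑ ^ 2 = ‖V‖ₑ ^ 2 := fun V => by
    rw [Lp.enorm_def, eLpNorm_eq_lintegral_rpow_enorm_toReal (by norm_num) (by norm_num)]
    rw [← ENNReal.rpow_natCast, ← ENNReal.rpow_mul]
    norm_num
  rw [key, key, ← ofReal_norm, h, ofReal_norm]

/-! ### Laplace transform of a power in the right half plane. -/

theorem integrableOn_rpow_mul_exp {a b : ℝ} (ha : 0 < a) (hb : 0 < b) :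
    IntegrableOn (fun t : ℝ => t ^ (a - 1) * Real.exp (-(b * t))) (Ioi 0) := by
  have := integrableOn_rpow_mul_exp_neg_mul_rpow (s := a - 1) (p := 1) (by linarith) one_pos hb
  simpa using this

/-- The Laplace transform of a power, at complex frequencies in the right half plane. -/
theorem integral_rpow_mul_cexp_neg_mul {a : ℝ} (ha : 0 < a) {w : ℂ} (hw : 0 < w.re) :
    ∫ t in Ioi (0 : ℝ), ((t ^ (a - 1) : ℝ) : ℂ) * Complex.exp (-(w * t)) =
      Real.Gamma a * w ^ (-a : ℂ) := by
  set H : Set ℂ := {z | 0 < z.re}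
  have hH : IsOpen H := isOpen_lt continuous_const Complex.continuous_re
  have hconv : IsPreconnected H := (convex_halfSpace_re_gt 0).isPreconnected
  have hmeas : ∀ z : ℂ, AEStronglyMeasurable
      (fun t : ℝ => ((t ^ (a - 1) : ℝ) : ℂ) * Complex.exp (-(z * t)))
      (volume.restrict (Ioi 0)) := fun z => by
    refine Measurable.aestronglyMeasurable ?_
    fun_prop
  have hL : DifferentiableOn ℂ
      (fun z : ℂ => ∫ t in Ioi (0 : ℝ), ((t ^ (a - 1) : ℝ) : ℂ) * Complex.exp (-(z * t))) H := by
    intro z hz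
    have hz' : 0 < z.re / 2 := half_pos hz
    -- On the ball of radius `z.re / 2` real parts stay above `z.re / 2`, so a single exponential
    -- dominates all the derivatives.
    refine (hasDerivAt_integral_of_dominated_loc_of_deriv_le (μ := volume.restrict (Ioi 0))
      (F' := fun z t => ((t ^ (a - 1) : ℝ) : ℂ) * (Complex.exp (-(z * t)) * (-t)))
      (bound := fun t => t ^ (a + 1 - 1) * Real.exp (-(z.re / 2 * t)))
      (s := Metric.ball z (z.re / 2))
      (Metric.ball_mem_nhds z hz') (.of_forall hmeas) ?_ ?_ ?_ ?_ ?_).2.differentiableAt.differentiableWithinAt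
    · refine (integrableOn_rpow_mul_exp ha hz).mono' (hmeas z) ?_
      filter_upwards [ae_restrict_mem measurableSet_Ioi] with t ht
      rw [norm_mul, Complex.norm_exp, Complex.norm_real, Real.norm_of_nonneg
        (Real.rpow_nonneg (le_of_lt ht) _)]
      simp
    · refine Measurable.aestronglyMeasurable ?_
      fun_prop
    · filter_upwards [ae_restrict_mem measurableSet_Ioi] with t ht x hx
      have ht : 0 < t := ht
      rw [norm_mul, norm_mul, Complex.norm_exp, Complex.norm_real, Real.norm_of_nonneg
        (Real.rpow_nonneg ht.le _), norm_neg, Complex.norm_real, Real.norm_of_nonneg ht.le,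
        show a + 1 - 1 = a - 1 + 1 by ring, Real.rpow_add_one ht.ne', mul_comm (Real.exp _),
        ← mul_assoc]
      gcongr
      have h1 := (Complex.abs_re_le_norm (x - z)).trans (mem_ball_iff_norm.1 hx).le
      rw [abs_le, Complex.sub_re] at h1
      simp
      nlinarith
    · exact integrableOn_rpow_mul_exp (by linarith) hz'
    · refine .of_forall fun t x _ => ?_
      have : HasDerivAt (fun y : ℂ => -(y * t)) (-t) x := by
        simpa using! ((hasDerivAt_id x).mul_const (t : ℂ)).neg
      exact this.cexp.const_mul _
  have hR : DifferentiableOn ℂ (fun z : ℂ => Real.Gamma a * z ^ (-a : ℂ)) H := fun z hz =>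
    ((differentiableAt_id.cpow_const (Or.inl hz)).const_mul _).differentiableWithinAt
  -- Identity theorem: both sides are analytic on the half plane and agree on the positive reals, by
  -- the Gamma integral; these accumulate at `1`.
  refine AnalyticOnNhd.eqOn_of_preconnected_of_frequently_eq (hL.analyticOnNhd hH)
    (hR.analyticOnNhd hH) hconv (z₀ := 1) (by simp [H]) ?_ hw
  have hev : ∀ r : ℝ, 0 < r → ∫ t in Ioi (0 : ℝ), ((t ^ (a - 1) : ℝ) : ℂ) * Complex.exp (-((r : ℂ) * t))
      = Real.Gamma a * (r : ℂ) ^ (-a : ℂ) := fun r hr => by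
    have h1 := Real.integral_rpow_mul_exp_neg_mul_Ioi ha hr
    have h2 := congrArg (fun x : ℝ => (x : ℂ)) h1
    simp only [← integral_complex_ofReal] at h2
    rw [← Complex.ofReal_neg, ← Complex.ofReal_cpow hr.le, Real.rpow_neg hr.le,
      ← Real.inv_rpow hr.le, mul_comm, ← Complex.ofReal_mul, ← one_div, ← h2]
    simp only [Complex.ofReal_mul, Complex.ofReal_exp, Complex.ofReal_neg]
  have htend : Tendsto (fun r : ℝ => (r : ℂ)) (𝓝[≠] 1) (𝓝[≠] 1) := by
    refine tendsto_nhdsWithin_of_tendsto_nhds_of_eventually_within _ ?_ ?_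
    · exact (Complex.continuous_ofReal.tendsto' 1 1 (by simp)).mono_left nhdsWithin_le_nhds
    · filter_upwards [self_mem_nhdsWithin] with r hr
      simpa using hr
  refine htend.frequently (Eventually.frequently ?_)
  filter_upwards [nhdsWithin_le_nhds (Ioi_mem_nhds (zero_lt_one' ℝ))] with r hr using hev r hr

/-! ### The Gagliardo seminorm as a Fourier energy. -/

/-- The homogeneous Fourier energy `∫ |ξ|^{2α} |û(ξ)|² dξ`. -/
def fourierEnergy (α : ℝ) (u : L2) : ℝ≥0∞ :=
  ∫⁻ ξ, ENNReal.ofReal (|ξ| ^ (2 * α)) * ‖hat u ξ‖ₑ ^ 2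

/-- The ratio between the squared Gagliardo seminorm and the Fourier energy. -/
def gagliardoConst (α : ℝ) : ℝ≥0∞ :=
  ∫⁻ s : ℝ, ENNReal.ofReal (‖(Real.fourierChar s : ℂ) - 1‖ ^ 2 / |s| ^ (1 + 2 * α))

/-- Plancherel for the difference of `u` and its translate, whose transform is `û` times the
character minus one. -/
theorem lintegral_sq_sub_translate (u : L2) (h : ℝ) :
    ∫⁻ x, ENNReal.ofReal (|u x - u (x + h)| ^ 2) =
      ∫⁻ ξ, ENNReal.ofReal (‖(Real.fourierChar (h * ξ) : ℂ) - 1‖ ^ 2) * ‖hat u ξ‖ₑ ^ 2 := by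
  set U : Lp ℂ 2 (volume : Measure ℝ) := Complex.ofRealCLM.compLp u with hU
  have hmp := measurePreserving_add_right (volume : Measure ℝ) h
  set W : Lp ℂ 2 (volume : Measure ℝ) := Lp.compMeasurePreserving (· + h) hmp U
  have hW : ∀ᵐ x, W x = U (x + h) := Lp.coeFn_compMeasurePreserving U hmp
  have hUu : ∀ᵐ x, U x = u x := Complex.ofRealCLM.coeFn_compLp u
  have hsub : (𝓕 (W - U) : Lp ℂ 2 (volume : Measure ℝ)) = 𝓕 W - 𝓕 U :=
    (Lp.fourierTransformₗᵢ ℝ ℂ).map_sub W U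
  have key := lintegral_enorm_sq_lp (W - U)
  rw [hsub] at key
  trans ∫⁻ x, ‖(W - U) x‖ₑ ^ 2
  · refine lintegral_congr_ae ?_
    filter_upwards [hW, hUu, hmp.quasiMeasurePreserving.ae hUu, Lp.coeFn_sub W U] with x h1 h2 h3 h4
    rw [h4, Pi.sub_apply, h1, h2, h3, ← ofReal_norm, ← ENNReal.ofReal_pow (norm_nonneg _),
      ← Complex.ofReal_sub, Complex.norm_real, Real.norm_eq_abs, abs_sub_comm]
  · rw [← key]
    refine lintegral_congr_ae ?_
    filter_upwards [fourier_lp_translate hW, Lp.coeFn_sub (𝓕 W) (𝓕 U)] with ξ h1 h2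
    rw [h2, Pi.sub_apply, h1, ENNReal.ofReal_pow (norm_nonneg _), ofReal_norm, ← mul_pow,
      ← enorm_mul, sub_mul, one_mul]
    rfl

theorem measurable_fourierChar : Measurable fun s : ℝ => (Real.fourierChar s : ℂ) :=
  (continuous_subtype_val.comp Real.continuous_fourierChar).measurable

/-- Substitute `s = ξ h`: the weight contributes `|ξ|^{1+2α}` and the Jacobian removes one power. -/
theorem lintegral_fourierChar_scale (α : ℝ) {ξ : ℝ} (hξ : ξ ≠ 0) :
    ∫⁻ h : ℝ, ENNReal.ofReal (‖(Real.fourierChar (h * ξ) : ℂ) - 1‖ ^ 2 / |h| ^ (1 + 2 * α)) =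
      gagliardoConst α * ENNReal.ofReal (|ξ| ^ (2 * α)) := by
  have hξ' : 0 < |ξ| := abs_pos.2 hξ
  set k : ℝ → ℝ≥0∞ := fun s =>
    ENNReal.ofReal (‖(Real.fourierChar s : ℂ) - 1‖ ^ 2 / |s| ^ (1 + 2 * α)) with hk
  have hm : Measurable k := by
    have := measurable_fourierChar
    fun_prop
  have h1 : ∀ h : ℝ, ENNReal.ofReal (‖(Real.fourierChar (h * ξ) : ℂ) - 1‖ ^ 2 / |h| ^ (1 + 2 * α)) =
      ENNReal.ofReal (|ξ| ^ (1 + 2 * α)) * k (ξ * h) := fun h => by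
    rw [hk, ← ENNReal.ofReal_mul (by positivity), abs_mul, Real.mul_rpow hξ'.le (abs_nonneg _),
      mul_comm h]
    congr 1
    have : 0 < |ξ| ^ (1 + 2 * α) := by positivity
    field_simp
  simp_rw [h1]
  rw [lintegral_const_mul _ (by fun_prop), ← lintegral_map hm (measurable_const_mul ξ), Real.map_volume_mul_left hξ,
    lintegral_smul_measure, smul_eq_mul, ← mul_assoc, ← ENNReal.ofReal_mul (by positivity),
    mul_comm]
  congr 2
  rw [abs_inv, Real.rpow_add hξ', Real.rpow_one]
  field_simp

/-- Tonelli twice: with `h = y - x` outermost, Plancherel applies in `x`; with `ξ` outermost, the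
`h`-integral is the scaled constant. Since this is an identity in `ℝ≥0∞`, it also decides
membership. -/
theorem gagliardoSeminorm_sq (α : ℝ) (u : L2) :
    gagliardoSeminorm α u ^ 2 = gagliardoConst α * fourierEnergy α u := by
  have hu : Measurable u := (Lp.stronglyMeasurable u).measurable
  have hhat : Measurable (hat u) := (Lp.stronglyMeasurable (hat u)).measurable
  have hchar := measurable_fourierChar
  have h0 : gagliardoSeminorm α u ^ 2 =
      ∫⁻ x : ℝ, ∫⁻ y : ℝ, ENNReal.ofReal (|u x - u y| ^ 2 / |x - y| ^ (1 + 2 * α)) := by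
    rw [gagliardoSeminorm, ← ENNReal.rpow_natCast, ← ENNReal.rpow_mul]
    norm_num
  have h1 : ∀ x, ∫⁻ y : ℝ, ENNReal.ofReal (|u x - u y| ^ 2 / |x - y| ^ (1 + 2 * α)) =
      ∫⁻ h : ℝ, ENNReal.ofReal (|u x - u (x + h)| ^ 2) / ENNReal.ofReal (|h| ^ (1 + 2 * α)) := by
    intro x
    rw [← lintegral_add_left_eq_self _ x]
    refine lintegral_congr_ae ?_
    filter_upwards [Measure.ae_ne volume (0 : ℝ)] with h hh
    have : 0 < |h| ^ (1 + 2 * α) := Real.rpow_pos_of_pos (abs_pos.2 hh) _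
    rw [ENNReal.ofReal_div_of_pos (by simpa using this)]
    simp
  simp_rw [h0, h1]
  rw [lintegral_lintegral_swap (by fun_prop), fourierEnergy,
    ← lintegral_const_mul _ (by fun_prop)]
  have h2 : ∀ h : ℝ, ∫⁻ x, ENNReal.ofReal (|u x - u (x + h)| ^ 2) /
      ENNReal.ofReal (|h| ^ (1 + 2 * α)) =
      ∫⁻ ξ, ENNReal.ofReal (‖(Real.fourierChar (h * ξ) : ℂ) - 1‖ ^ 2) /
        ENNReal.ofReal (|h| ^ (1 + 2 * α)) * ‖hat u ξ‖ₑ ^ 2 := fun h => by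
    simp_rw [div_eq_mul_inv]
    rw [lintegral_mul_const _ (by fun_prop), lintegral_sq_sub_translate,
      ← lintegral_mul_const _ (by fun_prop)]
    exact lintegral_congr fun ξ => by ring
  simp_rw [h2]
  rw [lintegral_lintegral_swap (by fun_prop)]
  refine lintegral_congr_ae ?_
  filter_upwards [Measure.ae_ne volume (0 : ℝ)] with ξ hξ
  rw [lintegral_mul_const _ (by fun_prop), ← mul_assoc, ← lintegral_fourierChar_scale α hξ]
  congr 1
  refine lintegral_congr_ae ?_
  filter_upwards [Measure.ae_ne volume (0 : ℝ)] with h hh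
  rw [ENNReal.ofReal_div_of_pos (Real.rpow_pos_of_pos (abs_pos.2 hh) _)]

theorem norm_fourierChar_sub_one_le (s : ℝ) :
    ‖(Real.fourierChar s : ℂ) - 1‖ ≤ 2 * Real.pi * |s| := by
  rw [Real.fourierChar_apply, mul_comm]
  refine (Real.norm_exp_I_mul_ofReal_sub_one_le).trans ?_
  rw [Real.norm_eq_abs, abs_mul, abs_of_pos Real.two_pi_pos]

/-- Near `0` the bound `|e^{2πis} - 1| ≤ 2π|s|` leaves `s^{1-2α}`, integrable as `α < 1`; beyond `1`
the bound by `2` leaves `s^{-1-2α}`, integrable as `0 < α`. -/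
theorem gagliardoConst_ne_top {α : ℝ} (h0 : 0 < α) (h1 : α < 1) : gagliardoConst α ≠ ⊤ := by
  have hchar := measurable_fourierChar
  set k : ℝ → ℝ := fun s => ‖(Real.fourierChar s : ℂ) - 1‖ ^ 2 / |s| ^ (1 + 2 * α) with hk
  have hkm : Measurable k := by fun_prop
  have heven : ∀ s, k (-s) = k s := fun s => by
    simp only [hk, abs_neg]
    congr 2
    rw [← Complex.norm_conj]
    simp [AddChar.map_neg_eq_inv]
  have hpos : IntegrableOn k (Ioi 0) := by
    rw [← Ioc_union_Ioi_eq_Ioi zero_le_one]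
    refine IntegrableOn.union ?_ ?_
    · have hi : IntegrableOn (fun s : ℝ => (2 * Real.pi) ^ 2 * s ^ (1 - 2 * α)) (Ioc 0 1) :=
        (((intervalIntegral.intervalIntegrable_rpow' (by linarith)).1)).const_mul _
      refine hi.mono' hkm.aestronglyMeasurable ?_
      filter_upwards [ae_restrict_mem measurableSet_Ioc] with s hs
      have hs0 : 0 < s := hs.1
      rw [Real.norm_of_nonneg (by positivity), div_le_iff₀ (by positivity), abs_of_pos hs0,
        mul_assoc, ← Real.rpow_add hs0, show 1 - 2 * α + (1 + 2 * α) = (2 : ℕ) by norm_num,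
        Real.rpow_natCast, ← mul_pow]
      gcongr
      simpa [abs_of_pos hs0] using norm_fourierChar_sub_one_le s
    · have hi : IntegrableOn (fun s : ℝ => 4 * s ^ (-(1 + 2 * α))) (Ioi 1) :=
        (integrableOn_Ioi_rpow_of_lt (by linarith) one_pos).const_mul _
      refine hi.mono' hkm.aestronglyMeasurable ?_
      filter_upwards [ae_restrict_mem measurableSet_Ioi] with s hs
      have hs0 : 0 < s := one_pos.trans hs
      rw [Real.norm_of_nonneg (by positivity), Real.rpow_neg hs0.le]
      simp only [hk]
      rw [abs_of_pos hs0, div_eq_mul_inv]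
      gcongr
      have : ‖(Real.fourierChar s : ℂ) - 1‖ ≤ 2 := by
        have h6 := norm_sub_le (Real.fourierChar s : ℂ) 1
        have h7 : ‖(Real.fourierChar s : ℂ)‖ = 1 := Circle.norm_coe _
        rw [h7, norm_one] at h6
        linarith
      nlinarith [norm_nonneg ((Real.fourierChar s : ℂ) - 1)]
  have hneg : IntegrableOn k (Iic 0) := by
    rw [← integrableOn_Ici_iff_integrableOn_Ioi] at hpos
    have := hpos.comp_neg
    simpa [heven] using this
  have hint : Integrable k := by
    rw [← integrableOn_univ, ← Iic_union_Ioi (a := (0 : ℝ))]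
    exact hneg.union hpos
  exact hint.lintegral_lt_top.ne

theorem gagliardoConst_ne_zero (α : ℝ) : gagliardoConst α ≠ 0 := by
  have hchar := measurable_fourierChar
  intro h
  rw [gagliardoConst, lintegral_eq_zero_iff (by fun_prop)] at h
  -- The character equals `1` only at integers, so the integrand is positive throughout `(0, 1)`.
  have h2 : ∀ᵐ s : ℝ, s ∉ Ioo (0 : ℝ) 1 := by
    filter_upwards [h] with s hs hs'
    have hs0 : 0 < s := hs'.1
    have h3 : ‖(Real.fourierChar s : ℂ) - 1‖ ^ 2 / |s| ^ (1 + 2 * α) ≤ 0 := by simpa using hs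
    have h5 : 0 < |s| ^ (1 + 2 * α) := Real.rpow_pos_of_pos (abs_pos.2 hs0.ne') _
    rw [div_le_iff₀ h5, zero_mul] at h3
    have h4 : (Real.fourierChar s : ℂ) = 1 := by
      rw [← sub_eq_zero, ← norm_eq_zero]
      nlinarith [sq_nonneg ‖(Real.fourierChar s : ℂ) - 1‖]
    rw [Real.fourierChar_apply, Complex.exp_eq_one_iff] at h4
    obtain ⟨n, hn⟩ := h4
    have hn' : s = n := by
      have h6 : ((2 * Real.pi * Complex.I : ℂ)) ≠ 0 := Complex.two_pi_I_ne_zero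
      have : (s : ℂ) = n := mul_right_cancel₀ h6 (by rw [← hn]; push_cast; ring)
      exact_mod_cast this
    rw [hn'] at hs'
    have h7 : (0 : ℤ) < n := by exact_mod_cast hs'.1
    have h8 : n < (1 : ℤ) := by exact_mod_cast hs'.2
    omega
  have : volume (Ioo (0 : ℝ) 1) = 0 := by
    simpa only [ae_iff, not_not, ofPred_mem_eq] using h2
  simp at this

/-! ### The multiplier, the one-sided kernel and the classical derivative. -/

/-- The sign of a direction: `1` for the left derivative, `-1` for the right one. -/
def Side.sign : Side → ℝ
  | .left => 1
  | .right => -1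

theorem Side.abs_sign (s : Side) : |s.sign| = 1 := by
  cases s <;> simp [Side.sign]

theorem Side.sign_ne_zero (s : Side) : s.sign ≠ 0 := by
  cases s <;> simp [Side.sign]

/-- The Fourier multiplier `(± 2πiξ)^α` of the fractional derivative. -/
def fracMult (α : ℝ) (s : Side) (ξ : ℝ) : ℂ :=
  s.sign * (2 * Real.pi * Complex.I * ξ) * (2 * Real.pi * Complex.I * s.sign * ξ) ^ (-(1 - α : ℝ) : ℂ)

theorem norm_two_pi_I_sign_mul (s : Side) (ξ : ℝ) :
    ‖(2 * Real.pi * Complex.I * s.sign * ξ : ℂ)‖ = 2 * Real.pi * |ξ| := by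
  simp [s.abs_sign, abs_of_pos Real.pi_pos]

theorem norm_fracMult {α : ℝ} (h0 : 0 < α) (s : Side) (ξ : ℝ) :
    ‖fracMult α s ξ‖ = (2 * Real.pi * |ξ|) ^ α := by
  rcases eq_or_ne ξ 0 with rfl | hξ
  · simp [fracMult, Real.zero_rpow h0.ne']
  have hpos : 0 < 2 * Real.pi * |ξ| := by positivity
  have h1 : ‖(2 * Real.pi * Complex.I * ξ : ℂ)‖ = 2 * Real.pi * |ξ| := by
    simp [abs_of_pos Real.pi_pos]
  rw [fracMult, norm_mul, norm_mul, h1, ← Complex.ofReal_neg, Complex.norm_cpow_real,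
    norm_two_pi_I_sign_mul, Complex.norm_real, Real.norm_eq_abs, s.abs_sign, one_mul,
    ← Real.rpow_one_add' hpos.le (by linarith)]
  congr 1
  ring

theorem measurable_fracMult (α : ℝ) (s : Side) : Measurable (fracMult α s) := by
  unfold fracMult
  fun_prop

theorem locallyIntegrable_rpow {r : ℝ} (hr : -1 < r) : LocallyIntegrable fun t : ℝ => t ^ r := by
  rw [locallyIntegrable_iff]
  intro K hK
  obtain ⟨R, hR⟩ := hK.isBounded.subset_closedBall 0
  rw [Real.closedBall_eq_Icc, zero_sub, zero_add] at hR
  rcases le_or_gt 0 R with h | h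
  · refine IntegrableOn.mono_set ?_ hR
    rw [integrableOn_Icc_iff_integrableOn_Ioc]
    exact ((intervalIntegral.intervalIntegrable_rpow' hr).1)
  · rw [Icc_eq_empty (by linarith), subset_empty_iff] at hR
    simp [hR]

theorem locallyIntegrable_comp_neg {f : ℝ → ℝ} (hf : LocallyIntegrable f) :
    LocallyIntegrable fun t => f (-t) := by
  rw [locallyIntegrable_iff] at hf ⊢
  intro K hK
  simpa using (hf _ hK.neg).comp_neg

/-- The one-sided kernel `t^{-α}`, supported on the half line given by the direction. -/
def fracKernel (α : ℝ) (s : Side) (t : ℝ) : ℝ :=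
  (Ioi (0 : ℝ)).indicator (fun t => t ^ (-α)) (s.sign * t)

theorem locallyIntegrable_fracKernel {α : ℝ} (h1 : α < 1) (s : Side) :
    LocallyIntegrable (fracKernel α s) := by
  have h : LocallyIntegrable ((Ioi (0 : ℝ)).indicator fun t => t ^ (-α)) :=
    (locallyIntegrable_rpow (by linarith)).indicator measurableSet_Ioi
  cases s
  · convert h using 1
    ext t
    simp [fracKernel, Side.sign]
  · convert locallyIntegrable_comp_neg h using 1
    ext t
    simp [fracKernel, Side.sign]

theorem integral_mul_fracKernel (α : ℝ) (s : Side) (f : ℝ → ℝ) (x : ℝ) :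
    ∫ y, f y * fracKernel α s (x - y) = ∫ t in Ioi (0 : ℝ), f (x - s.sign * t) * t ^ (-α) := by
  have h : ∀ g : ℝ → ℝ, ∫ t, g (s.sign * t) = ∫ t, g t := fun g => by
    rw [Measure.integral_comp_mul_left, abs_inv, s.abs_sign]
    simp
  have hs : s.sign * s.sign = 1 := by cases s <;> simp [Side.sign]
  rw [← integral_sub_left_eq_self _ volume x, ← h, ← integral_indicator measurableSet_Ioi]
  refine integral_congr_ae (.of_forall fun t => ?_)
  simp only [fracKernel, sub_sub_cancel, ← mul_assoc, hs, one_mul, indicator]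
  split_ifs <;> simp

/-- The fractional integral is a convolution of `φ` with a locally integrable kernel, so the
derivative may fall on the smooth factor, never on the singular one. -/
theorem classicalDeriv_eq {α : ℝ} (h1 : α < 1) {φ : ℝ → ℝ} (hφ : IsTestFunction φ) (s : Side)
    (x : ℝ) :
    classicalDeriv α φ s x =
      s.sign * (Real.Gamma (1 - α))⁻¹ * ∫ t in Ioi (0 : ℝ), deriv φ (x - s.sign * t) * t ^ (-α) := by
  have hd := hφ.2.hasDerivAt_convolution_left (ContinuousLinearMap.mul ℝ ℝ) (μ := volume)
    (hφ.1.of_le (by simp)) (locallyIntegrable_fracKernel h1 s) x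
  have hd' : deriv (fun z => ∫ y, φ y * fracKernel α s (z - y)) x =
      ∫ t in Ioi (0 : ℝ), deriv φ (x - s.sign * t) * t ^ (-α) := by
    rw [← integral_mul_fracKernel]
    exact hd.deriv
  rw [← hd']
  cases s
  · simp only [classicalDeriv, Side.sign, one_mul]
    congr 2
    ext z
    rw [← integral_indicator measurableSet_Iio]
    refine integral_congr_ae (.of_forall fun y => ?_)
    simp [fracKernel, indicator, Side.sign]
  · simp only [classicalDeriv, Side.sign, neg_mul, one_mul]
    congr 3
    ext z
    rw [← integral_indicator measurableSet_Ioi]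
    refine integral_congr_ae (.of_forall fun y => ?_)
    simp [fracKernel, indicator, Side.sign]

/-! ### The classical derivative as a Fourier multiplier. -/

/-- Insert Fourier inversion for `Φ` and swap the integrals; the `t`-integral is a Laplace transform
at `ε + 2πiσξ`. The damping `ε > 0` supplies the integrability at infinity that Fubini needs and
`t^{-α}` lacks. -/
theorem integral_schwartz_mul_rpow_exp {α : ℝ} (h1 : α < 1) (Φ : 𝓢(ℝ, ℂ)) (σ x : ℝ) {ε : ℝ}
    (hε : 0 < ε) :
    ∫ t in Ioi (0 : ℝ), Φ (x - σ * t) * ((t ^ (-α) * Real.exp (-(ε * t)) : ℝ) : ℂ) =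
      ∫ ξ : ℝ, Complex.exp (↑(2 * Real.pi * (x * ξ)) * Complex.I) * 𝓕 Φ ξ *
        (Real.Gamma (1 - α) *
          (ε + 2 * Real.pi * Complex.I * σ * ξ : ℂ) ^ (-(1 - α : ℝ) : ℂ)) := by
  have ha : 0 < 1 - α := by linarith
  have hinv : ∀ y, Φ y = ∫ ξ : ℝ, Complex.exp (↑(2 * Real.pi * (ξ * y)) * Complex.I) * 𝓕 Φ ξ := by
    intro y
    have h := congrArg (fun Ψ : 𝓢(ℝ, ℂ) => Ψ y) (FourierTransform.fourierInv_fourier_eq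
      (F := 𝓢(ℝ, ℂ)) Φ)
    simp only [SchwartzMap.fourierInv_coe, Real.fourierInv_eq'] at h
    simpa [mul_comm] using h.symm
  have hk : Integrable (fun t : ℝ => ((t ^ (-α) * Real.exp (-(ε * t)) : ℝ) : ℂ))
      (volume.restrict (Ioi 0)) := by
    have := integrableOn_rpow_mul_exp ha hε
    rw [show 1 - α - 1 = -α by ring] at this
    exact this.ofReal
  have hprod : Integrable (fun p : ℝ × ℝ =>
      Complex.exp (↑(2 * Real.pi * (p.2 * (x - σ * p.1))) * Complex.I) *
        (((p.1 ^ (-α) * Real.exp (-(ε * p.1)) : ℝ) : ℂ) * 𝓕 Φ p.2))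
      ((volume.restrict (Ioi 0)).prod volume) := by
    refine (hk.mul_prod (𝓕 Φ).integrable).bdd_mul (c := 1) ?_ ?_
    · exact Continuous.aestronglyMeasurable (by fun_prop)
    · exact .of_forall fun p => (Complex.norm_exp_ofReal_mul_I _).le
  trans ∫ t in Ioi (0 : ℝ), ∫ ξ : ℝ, Complex.exp (↑(2 * Real.pi * (ξ * (x - σ * t))) * Complex.I) *
        (((t ^ (-α) * Real.exp (-(ε * t)) : ℝ) : ℂ) * 𝓕 Φ ξ)
  · refine integral_congr_ae (.of_forall fun t => ?_)
    simp only
    rw [hinv, ← integral_mul_const]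
    refine integral_congr_ae (.of_forall fun ξ => ?_)
    simp only
    ring
  rw [integral_integral_swap hprod]
  refine integral_congr_ae (.of_forall fun ξ => ?_)
  simp only
  rw [← integral_rpow_mul_cexp_neg_mul ha (by simpa using hε), ← integral_const_mul]
  refine integral_congr_ae (.of_forall fun t => ?_)
  simp only
  rw [show 1 - α - 1 = -α by ring, Complex.ofReal_mul (t ^ (-α)), Complex.ofReal_exp]
  have : Complex.exp (↑(2 * Real.pi * (ξ * (x - σ * t))) * Complex.I) *
      Complex.exp (↑(-(ε * t))) = Complex.exp (↑(2 * Real.pi * (x * ξ)) * Complex.I) *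
        Complex.exp (-((ε + 2 * Real.pi * Complex.I * σ * ξ) * t)) := by
    rw [← Complex.exp_add, ← Complex.exp_add]
    congr 1
    push_cast
    ring
  linear_combination ((t ^ (-α) : ℝ) : ℂ) * 𝓕 Φ ξ * this

theorem IsTestFunction.hasCompactSupport_ofReal {φ : ℝ → ℝ} (hφ : IsTestFunction φ) :
    HasCompactSupport (Complex.ofRealCLM ∘ φ) := hφ.2.comp_left rfl

/-- A real test function as a complex Schwartz function. -/
def IsTestFunction.toSchwartz {φ : ℝ → ℝ} (hφ : IsTestFunction φ) : 𝓢(ℝ, ℂ) :=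
  hφ.hasCompactSupport_ofReal.toSchwartzMap (Complex.ofRealCLM.contDiff.comp hφ.1)

@[simp]
theorem IsTestFunction.toSchwartz_apply {φ : ℝ → ℝ} (hφ : IsTestFunction φ) (x : ℝ) :
    hφ.toSchwartz x = φ x := rfl

theorem deriv_toSchwartz_apply {φ : ℝ → ℝ} (hφ : IsTestFunction φ) (x : ℝ) :
    SchwartzMap.derivCLM ℂ ℂ hφ.toSchwartz x = ((deriv φ x : ℝ) : ℂ) := by
  rw [SchwartzMap.derivCLM_apply]
  exact ((hφ.1.differentiable (by simp)) x).hasDerivAt.ofReal_comp.deriv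

theorem fourier_derivCLM (Φ : 𝓢(ℝ, ℂ)) (ξ : ℝ) :
    𝓕 (SchwartzMap.derivCLM ℂ ℂ Φ) ξ = 2 * Real.pi * Complex.I * ξ * 𝓕 Φ ξ := by
  have h1 : (SchwartzMap.derivCLM ℂ ℂ Φ : ℝ → ℂ) = deriv Φ :=
    funext fun x => SchwartzMap.derivCLM_apply ..
  have h2 : Integrable (deriv Φ) := by
    rw [← h1]
    exact SchwartzMap.integrable _
  rw [SchwartzMap.fourier_coe, h1, Real.fourier_deriv Φ.integrable Φ.differentiable h2,
    SchwartzMap.fourier_coe]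
  rfl

theorem norm_fourier_derivCLM (Φ : 𝓢(ℝ, ℂ)) (ξ : ℝ) :
    ‖𝓕 (SchwartzMap.derivCLM ℂ ℂ Φ) ξ‖ = 2 * Real.pi * |ξ| * ‖𝓕 Φ ξ‖ := by
  rw [fourier_derivCLM]
  simp [abs_of_pos Real.pi_pos]

/-- From `r^α ≤ 1 + r`. It bounds the nonsmooth multiplier by Schwartz functions, giving both `L^p`
membership and a dominating function for `ε → 0`. -/
theorem rpow_mul_norm_fourier_le {α : ℝ} (h0 : 0 < α) (h1 : α < 1) (Φ : 𝓢(ℝ, ℂ)) (ξ : ℝ) :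
    (2 * Real.pi * |ξ|) ^ α * ‖𝓕 Φ ξ‖ ≤ ‖𝓕 Φ ξ‖ + ‖𝓕 (SchwartzMap.derivCLM ℂ ℂ Φ) ξ‖ := by
  have hx : 0 ≤ 2 * Real.pi * |ξ| := by positivity
  rw [norm_fourier_derivCLM, ← one_add_mul]
  gcongr
  rcases le_total (2 * Real.pi * |ξ|) 1 with h | h
  · exact (Real.rpow_le_one hx h h0.le).trans (by linarith)
  · refine (Real.rpow_le_rpow_of_exponent_le h h1.le).trans ?_
    rw [Real.rpow_one]
    linarith

theorem memLp_fracMult_mul {α : ℝ} (h0 : 0 < α) (h1 : α < 1) (s : Side) (Φ : 𝓢(ℝ, ℂ)) (p : ℝ≥0∞) :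
    MemLp (fun ξ => fracMult α s ξ * 𝓕 Φ ξ) p := by
  refine (((𝓕 Φ).memLp p).norm.add ((𝓕 (SchwartzMap.derivCLM ℂ ℂ Φ)).memLp p).norm).mono
    ((measurable_fracMult α s).mul (𝓕 Φ).continuous.measurable).aestronglyMeasurable
    (.of_forall fun ξ => ?_)
  rw [Pi.mul_apply, norm_mul, norm_fracMult h0]
  exact (rpow_mul_norm_fourier_le h0 h1 Φ ξ).trans (le_abs_self _)

/-- Remove the damping by dominated convergence on both sides of `integral_schwartz_mul_rpow_exp`,
applied to the derivative of the test function. -/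
theorem integral_deriv_mul_rpow {α : ℝ} (h0 : 0 < α) (h1 : α < 1) {φ : ℝ → ℝ}
    (hφ : IsTestFunction φ) (s : Side) (x : ℝ) :
    ((∫ t in Ioi (0 : ℝ), deriv φ (x - s.sign * t) * t ^ (-α) : ℝ) : ℂ) =
      ∫ ξ : ℝ, Complex.exp (↑(2 * Real.pi * (x * ξ)) * Complex.I) *
        𝓕 (SchwartzMap.derivCLM ℂ ℂ hφ.toSchwartz) ξ * (Real.Gamma (1 - α) *
          (2 * Real.pi * Complex.I * s.sign * ξ : ℂ) ^ (-(1 - α : ℝ) : ℂ)) := by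
  set Φ := SchwartzMap.derivCLM ℂ ℂ hφ.toSchwartz with hΦ
  have hΓ : 0 < Real.Gamma (1 - α) := Real.Gamma_pos_of_pos (by linarith)
  rw [← integral_complex_ofReal]
  have hpos : ∀ᶠ ε : ℝ in 𝓝[>] 0, 0 < ε := self_mem_nhdsWithin
  have hL : Tendsto (fun ε : ℝ => ∫ t in Ioi (0 : ℝ), Φ (x - s.sign * t) *
      ((t ^ (-α) * Real.exp (-(ε * t)) : ℝ) : ℂ)) (𝓝[>] 0)
      (𝓝 (∫ t in Ioi (0 : ℝ), ((deriv φ (x - s.sign * t) * t ^ (-α) : ℝ) : ℂ))) := by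
    refine tendsto_integral_filter_of_dominated_convergence
      (fun t => ‖deriv φ (x - s.sign * t) * t ^ (-α)‖) ?_ ?_ ?_ ?_
    · refine .of_forall fun ε => Measurable.aestronglyMeasurable ?_
      have : Measurable Φ := Φ.continuous.measurable
      fun_prop
    · filter_upwards [hpos] with ε hε
      filter_upwards [ae_restrict_mem measurableSet_Ioi] with t ht
      have ht : 0 < t := ht
      rw [hΦ, deriv_toSchwartz_apply, ← Complex.ofReal_mul, Complex.norm_real, ← mul_assoc,
        norm_mul _ (Real.exp _), Real.norm_of_nonneg (Real.exp_nonneg _)]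
      refine mul_le_of_le_one_right (norm_nonneg _) (Real.exp_le_one_iff.2 ?_)
      have := mul_pos hε ht
      linarith
    · refine Integrable.norm (Integrable.integrableOn ?_)
      have hc : Continuous fun t => deriv φ (x - s.sign * t) :=
        (hφ.1.continuous_deriv (by simp)).comp (by fun_prop)
      have hcs : HasCompactSupport fun t => deriv φ (x - s.sign * t) := by
        refine hφ.2.deriv.comp_isClosedEmbedding (g := fun t => x - s.sign * t) ?_
        exact ((Homeomorph.mulLeft₀ s.sign s.sign_ne_zero).trans
          (Homeomorph.subLeft x)).isClosedEmbedding
      exact (locallyIntegrable_rpow (by linarith)).integrable_smul_left_of_hasCompactSupport hc hcs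
    · refine .of_forall fun t => ?_
      rw [hΦ, deriv_toSchwartz_apply, Complex.ofReal_mul]
      refine Tendsto.mono_left ?_ nhdsWithin_le_nhds
      refine Tendsto.const_mul _ ?_
      have : Continuous fun ε : ℝ => ((t ^ (-α) * Real.exp (-(ε * t)) : ℝ) : ℂ) := by fun_prop
      exact this.tendsto' _ _ (by simp)
  have hR : Tendsto (fun ε : ℝ => ∫ ξ : ℝ, Complex.exp (↑(2 * Real.pi * (x * ξ)) * Complex.I) *
        𝓕 Φ ξ * (Real.Gamma (1 - α) *
          (ε + 2 * Real.pi * Complex.I * s.sign * ξ : ℂ) ^ (-(1 - α : ℝ) : ℂ))) (𝓝[>] 0)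
      (𝓝 (∫ ξ : ℝ, Complex.exp (↑(2 * Real.pi * (x * ξ)) * Complex.I) *
        𝓕 Φ ξ * (Real.Gamma (1 - α) *
          (2 * Real.pi * Complex.I * s.sign * ξ : ℂ) ^ (-(1 - α : ℝ) : ℂ)))) := by
    refine tendsto_integral_filter_of_dominated_convergence
      (fun ξ => Real.Gamma (1 - α) * (‖𝓕 hφ.toSchwartz ξ‖ + ‖𝓕 Φ ξ‖)) ?_ ?_ ?_ ?_
    · refine .of_forall fun ε => Measurable.aestronglyMeasurable ?_
      have : Measurable fun ξ => 𝓕 Φ ξ := (𝓕 Φ).continuous.measurable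
      fun_prop
    · filter_upwards [hpos] with ε hε
      filter_upwards [Measure.ae_ne volume (0 : ℝ)] with ξ hξ
      have hξ' : 0 < 2 * Real.pi * |ξ| := by positivity
      rw [norm_mul, norm_mul, Complex.norm_exp_ofReal_mul_I, one_mul, norm_mul,
        Complex.norm_real, Real.norm_of_nonneg hΓ.le, ← Complex.ofReal_neg, Complex.norm_cpow_real,
        mul_left_comm]
      refine mul_le_mul_of_nonneg_left (le_trans ?_ (rpow_mul_norm_fourier_le h0 h1 _ ξ)) hΓ.le
      rw [hΦ, norm_fourier_derivCLM, mul_right_comm]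
      refine mul_le_mul_of_nonneg_right ?_ (norm_nonneg _)
      rw [show (2 * Real.pi * |ξ|) ^ α = 2 * Real.pi * |ξ| * (2 * Real.pi * |ξ|) ^ (-(1 - α)) by
        rw [← Real.rpow_one_add' hξ'.le (by linarith)]; congr 1; ring]
      gcongr ?_ * ?_
      -- The exponent is negative, so a lower bound on the base is needed; the imaginary part gives
      -- one independent of `ε`.
      refine Real.rpow_le_rpow_of_nonpos hξ' ?_ (by linarith)
      refine le_trans (le_of_eq ?_) (Complex.abs_im_le_norm _)
      simp [abs_mul, abs_of_pos Real.pi_pos, s.abs_sign]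
    · exact ((𝓕 hφ.toSchwartz).integrable.norm.add (𝓕 Φ).integrable.norm).const_mul _
    · filter_upwards [Measure.ae_ne volume (0 : ℝ)] with ξ hξ
      refine Tendsto.mono_left ?_ nhdsWithin_le_nhds
      refine Tendsto.const_mul _ (Tendsto.const_mul _ ?_)
      -- For `ξ ≠ 0` the limiting base is nonzero and purely imaginary, hence off the branch cut.
      have hslit : ((0 : ℝ) : ℂ) + 2 * Real.pi * Complex.I * s.sign * ξ ∈ Complex.slitPlane := by
        right
        simp [hξ, s.sign_ne_zero, Real.pi_ne_zero]
      have hc : ContinuousAt (fun ε : ℝ => (ε : ℂ) + 2 * Real.pi * Complex.I * s.sign * ξ) 0 := by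
        fun_prop
      have := (hc.cpow (continuousAt_const (y := (-(1 - α : ℝ) : ℂ))) hslit).tendsto
      simpa using this
  refine tendsto_nhds_unique hL (hR.congr' ?_)
  filter_upwards [hpos] with ε hε
  rw [integral_schwartz_mul_rpow_exp h1 _ _ _ hε]

/-- The classical derivative acts on test functions as the Fourier multiplier `fracMult`. -/
theorem classicalDeriv_eq_fourierInv {α : ℝ} (h0 : 0 < α) (h1 : α < 1) {φ : ℝ → ℝ}
    (hφ : IsTestFunction φ) (s : Side) (x : ℝ) :
    (classicalDeriv α φ s x : ℂ) = 𝓕⁻ (fun ξ => fracMult α s ξ * 𝓕 hφ.toSchwartz ξ) x := by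
  have hΓ : (Real.Gamma (1 - α) : ℂ) ≠ 0 := by
    exact_mod_cast (Real.Gamma_pos_of_pos (by linarith : 0 < 1 - α)).ne'
  rw [classicalDeriv_eq h1 hφ, Complex.ofReal_mul, integral_deriv_mul_rpow h0 h1 hφ,
    Real.fourierInv_eq', ← integral_const_mul]
  refine integral_congr_ae (.of_forall fun ξ => ?_)
  simp only [fourier_derivCLM, fracMult, smul_eq_mul, RCLike.inner_apply, conj_trivial]
  push_cast
  field_simp

/-- The classical derivative of a test function is in `L²`, with an explicit Fourier transform. -/
theorem exists_lp_classicalDeriv {α : ℝ} (h0 : 0 < α) (h1 : α < 1) {φ : ℝ → ℝ}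
    (hφ : IsTestFunction φ) (s : Side) :
    ∃ D : Lp ℂ 2 (volume : Measure ℝ), (∀ᵐ x, D x = classicalDeriv α φ s x) ∧
      ∀ᵐ ξ, (𝓕 D : Lp ℂ 2 (volume : Measure ℝ)) ξ = fracMult α s ξ * 𝓕 hφ.toSchwartz ξ := by
  have hm := memLp_fracMult_mul h0 h1 s hφ.toSchwartz 2
  refine ⟨𝓕⁻ (hm.toLp _), ?_, ?_⟩
  · filter_upwards [coeFn_fourierInv_toLp
      (memLp_one_iff_integrable.1 (memLp_fracMult_mul h0 h1 s hφ.toSchwartz 1)) hm] with x hx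
    rw [hx, classicalDeriv_eq_fourierInv h0 h1 hφ]
  · rw [FourierTransform.fourier_fourierInv_eq]
    exact hm.coeFn_toLp

/-! ### Parseval pairings and the transform of a weak derivative. -/

theorem integral_mul_conj_fourier (V D : Lp ℂ 2 (volume : Measure ℝ)) :
    ∫ x, D x * conj (V x) = ∫ ξ, (𝓕 D : Lp ℂ 2 (volume : Measure ℝ)) ξ *
      conj ((𝓕 V : Lp ℂ 2 (volume : Measure ℝ)) ξ) := by
  have h := Lp.inner_fourier_eq V D
  rw [L2.inner_def, L2.inner_def] at h
  simpa only [RCLike.inner_apply] using h.symm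

theorem integral_schwartz_mul_conj (V : Lp ℂ 2 (volume : Measure ℝ)) (Φ : 𝓢(ℝ, ℂ)) :
    ∫ x, Φ x * conj (V x) = ∫ ξ, 𝓕 Φ ξ * conj ((𝓕 V : Lp ℂ 2 (volume : Measure ℝ)) ξ) := by
  have h := integral_mul_conj_fourier V (Φ.toLp 2)
  rw [SchwartzMap.toLp_fourier_eq] at h
  calc _ = _ := integral_congr_ae ?_
    _ = _ := h
    _ = _ := integral_congr_ae ?_
  · filter_upwards [Φ.coeFn_toLp 2 volume] with x hx using by rw [hx]
  · filter_upwards [(𝓕 Φ).coeFn_toLp 2 volume] with x hx using by rw [hx]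

theorem integral_mul_classicalDeriv {α : ℝ} (h0 : 0 < α) (h1 : α < 1) (u : L2) {φ : ℝ → ℝ}
    (hφ : IsTestFunction φ) (s : Side) :
    ((∫ x, u x * classicalDeriv α φ s x : ℝ) : ℂ) =
      ∫ ξ, fracMult α s ξ * 𝓕 hφ.toSchwartz ξ * conj (hat u ξ) := by
  obtain ⟨D, hD, hFD⟩ := exists_lp_classicalDeriv h0 h1 hφ s
  rw [← integral_complex_ofReal]
  calc _ = _ := integral_congr_ae ?_
    _ = _ := integral_mul_conj_fourier (Complex.ofRealCLM.compLp u) D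
    _ = _ := integral_congr_ae ?_
  · filter_upwards [hD, Complex.ofRealCLM.coeFn_compLp u] with x hx hu
    rw [hx, hu, Complex.ofRealCLM_apply, Complex.conj_ofReal, Complex.ofReal_mul, mul_comm]
  · filter_upwards [hFD] with x hx using by rw [hx]; rfl

theorem integral_mul_testFunction (v : L2) {φ : ℝ → ℝ} (hφ : IsTestFunction φ) :
    ((∫ x, v x * φ x : ℝ) : ℂ) = ∫ ξ, 𝓕 hφ.toSchwartz ξ * conj (hat v ξ) := by
  rw [← integral_complex_ofReal]
  calc _ = _ := integral_congr_ae ?_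
    _ = _ := integral_schwartz_mul_conj (Complex.ofRealCLM.compLp v) hφ.toSchwartz
  filter_upwards [Complex.ofRealCLM.coeFn_compLp v] with x hv
  rw [hv, Complex.ofRealCLM_apply, Complex.conj_ofReal, hφ.toSchwartz_apply, Complex.ofReal_mul,
    mul_comm]

theorem IsTestFunction.comp_add {φ : ℝ → ℝ} (hφ : IsTestFunction φ) (a : ℝ) :
    IsTestFunction fun x => φ (x + a) :=
  ⟨hφ.1.comp (by fun_prop), hφ.2.comp_isClosedEmbedding (Homeomorph.addRight a).isClosedEmbedding⟩

theorem IsTestFunction.comp_mul {φ : ℝ → ℝ} (hφ : IsTestFunction φ) {c : ℝ} (hc : c ≠ 0) :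
    IsTestFunction fun x => φ (c * x) :=
  ⟨hφ.1.comp (by fun_prop), hφ.2.comp_isClosedEmbedding (Homeomorph.mulLeft₀ c hc).isClosedEmbedding⟩

theorem fourier_toSchwartz {φ : ℝ → ℝ} (hφ : IsTestFunction φ) (ξ : ℝ) :
    𝓕 hφ.toSchwartz ξ = ∫ x : ℝ, (Real.fourierChar (-(x * ξ)) : ℂ) * φ x := by
  rw [SchwartzMap.fourier_coe, Real.fourier_real_eq]
  rfl

theorem coe_fourierChar_add (x y : ℝ) :
    (Real.fourierChar (x + y) : ℂ) = Real.fourierChar x * Real.fourierChar y := by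
  rw [AddChar.map_add_eq_mul]
  rfl

theorem fourier_comp_add {φ : ℝ → ℝ} (hφ : IsTestFunction φ) (a ξ : ℝ) :
    𝓕 (hφ.comp_add a).toSchwartz ξ = Real.fourierChar (a * ξ) * 𝓕 hφ.toSchwartz ξ := by
  rw [fourier_toSchwartz, fourier_toSchwartz, ← integral_sub_right_eq_self _ a,
    ← integral_const_mul]
  refine integral_congr_ae (.of_forall fun x => ?_)
  simp only [sub_add_cancel]
  rw [← mul_assoc, ← coe_fourierChar_add]
  ring_nf

theorem fourier_comp_mul {φ : ℝ → ℝ} (hφ : IsTestFunction φ) {c : ℝ} (hc : c ≠ 0) (ξ : ℝ) :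
    𝓕 (hφ.comp_mul hc).toSchwartz ξ = (|c⁻¹| : ℝ) * 𝓕 hφ.toSchwartz (ξ / c) := by
  rw [fourier_toSchwartz, fourier_toSchwartz, ← Complex.real_smul,
    ← Measure.integral_comp_mul_left]
  refine integral_congr_ae (.of_forall fun x => ?_)
  simp only
  congr 3
  field_simp

/-- A bump has nonzero integral, so its transform is nonzero near `0`; compressing the bump
stretches that neighbourhood over any bounded interval. This permits division by the transform of a
test function locally. -/
theorem exists_testFunction_fourier_ne_zero (R : ℝ) :
    ∃ (φ : ℝ → ℝ) (hφ : IsTestFunction φ), ∀ ξ, |ξ| < R → 𝓕 hφ.toSchwartz ξ ≠ 0 := by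
  let f : ContDiffBump (0 : ℝ) := default
  have hf : IsTestFunction f := ⟨f.contDiff, f.hasCompactSupport⟩
  have h0 : 𝓕 hf.toSchwartz 0 ≠ 0 := by
    have h : 𝓕 hf.toSchwartz 0 = ((∫ x, f x : ℝ) : ℂ) := by
      rw [fourier_toSchwartz, ← integral_complex_ofReal]
      simp
    rw [h]
    exact_mod_cast f.integral_pos.ne'
  have hev := (𝓕 hf.toSchwartz).continuous.continuousAt.eventually_ne h0
  obtain ⟨δ, hδ, hball⟩ := Metric.eventually_nhds_iff.1 hev
  set c : ℝ := (|R| + 1) / δ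
  have hc : 0 < c := by positivity
  refine ⟨_, hf.comp_mul hc.ne', fun ξ hξ => ?_⟩
  rw [fourier_comp_mul hf hc.ne']
  refine mul_ne_zero ?_ (hball ?_)
  · simpa using hc.ne'
  · rw [dist_zero_right, Real.norm_eq_abs, abs_div, abs_of_pos hc, div_lt_iff₀ hc]
    have : δ * c = |R| + 1 := by simp only [c]; field_simp
    rw [this]
    linarith [le_abs_self R]

theorem memLp_conj_hat (u : L2) : MemLp (fun ξ => conj (hat u ξ)) 2 :=
  (Lp.memLp (hat u)).star

/-- A weak fractional derivative in `L²` is given by the Fourier multiplier. -/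
theorem IsWeakFracDeriv.hat_eq {α : ℝ} (h0 : 0 < α) (h1 : α < 1) {s : Side} {u v : L2}
    (h : IsWeakFracDeriv s α u v) :
    ∀ᵐ ξ, hat v ξ = conj (fracMult α s.opp ξ) * hat u ξ := by
  set G : ℝ → ℂ := fun ξ => conj (hat v ξ) - fracMult α s.opp ξ * conj (hat u ξ) with hG
  have hint1 : ∀ Φ : 𝓢(ℝ, ℂ), Integrable fun ξ => 𝓕 Φ ξ * conj (hat v ξ) := fun Φ =>
    ((𝓕 Φ).memLp 2).integrable_mul (memLp_conj_hat v)
  have hint2 : ∀ Φ : 𝓢(ℝ, ℂ), Integrable fun ξ => fracMult α s.opp ξ * 𝓕 Φ ξ * conj (hat u ξ) :=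
    fun Φ => (memLp_fracMult_mul h0 h1 s.opp Φ 2).integrable_mul (memLp_conj_hat u)
  have hsplit : ∀ Φ : 𝓢(ℝ, ℂ), (fun ξ => 𝓕 Φ ξ * G ξ) =
      fun ξ => 𝓕 Φ ξ * conj (hat v ξ) - fracMult α s.opp ξ * 𝓕 Φ ξ * conj (hat u ξ) := fun Φ => by
    ext ξ
    simp only [hG]
    ring
  have hint : ∀ Φ : 𝓢(ℝ, ℂ), Integrable fun ξ => 𝓕 Φ ξ * G ξ := fun Φ => by
    rw [hsplit]
    exact (hint1 Φ).sub (hint2 Φ)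
  have hzero : ∀ {φ : ℝ → ℝ} (hφ : IsTestFunction φ), ∫ ξ, 𝓕 hφ.toSchwartz ξ * G ξ = 0 :=
    fun {φ} hφ => by
      rw [hsplit, integral_sub (hint1 _) (hint2 _), ← integral_mul_testFunction,
        ← integral_mul_classicalDeriv h0 h1, h.2 φ hφ, sub_self]
  -- Translating `φ` multiplies its transform by a character, so the vanishing pairings with all
  -- translates say that the Fourier transform of the integrable function `𝓕 φ * G` is zero.
  have hae : ∀ {φ : ℝ → ℝ} (hφ : IsTestFunction φ), ∀ᵐ ξ, 𝓕 hφ.toSchwartz ξ * G ξ = 0 :=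
    fun {φ} hφ => ae_eq_zero_of_fourier_eq_zero (hint _) fun a => by
      rw [Real.fourier_real_eq, ← hzero (hφ.comp_add (-a))]
      refine integral_congr_ae (.of_forall fun ξ => ?_)
      simp only
      rw [fourier_comp_add hφ (-a) ξ, Circle.smul_def, smul_eq_mul, ← mul_assoc,
        show -a * ξ = -(ξ * a) by ring]
  have hG0 : ∀ᵐ ξ : ℝ, ∀ n : ℕ, |ξ| < n → G ξ = 0 := ae_all_iff.2 fun n => by
    obtain ⟨φ, hφ, hne⟩ := exists_testFunction_fourier_ne_zero n
    filter_upwards [hae hφ] with ξ hξ hn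
    exact (mul_eq_zero.1 hξ).resolve_left (hne ξ hn)
  filter_upwards [hG0] with ξ hξ
  obtain ⟨n, hn⟩ := exists_nat_gt |ξ|
  have := congrArg conj (sub_eq_zero.1 (hξ n hn))
  simpa using this

/-! ### Each space and norm in terms of the energy. -/

theorem eLpNorm_two_sq {E : Type*} [NormedAddCommGroup E] {X : Type*} [MeasurableSpace X]
    {μ : Measure X} (f : X → E) : eLpNorm f 2 μ ^ 2 = ∫⁻ x, ‖f x‖ₑ ^ 2 ∂μ := by
  rw [eLpNorm_eq_lintegral_rpow_enorm_toReal (by norm_num) (by norm_num),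
    ← ENNReal.rpow_natCast, ← ENNReal.rpow_mul]
  norm_num

theorem lintegral_enorm_sq_hat (u : L2) : ∫⁻ ξ, ‖hat u ξ‖ₑ ^ 2 = eLpNorm u 2 volume ^ 2 := by
  rw [eLpNorm_two_sq, hat, lintegral_enorm_sq_lp]
  refine lintegral_congr_ae ?_
  filter_upwards [Complex.ofRealCLM.coeFn_compLp u] with x hx
  rw [hx, Complex.ofRealCLM_apply, ← ofReal_norm, Complex.norm_real, ofReal_norm]

theorem lintegral_enorm_sq_fracMult_mul {α : ℝ} (h0 : 0 < α) (s : Side) (u : L2) :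
    ∫⁻ ξ, ‖conj (fracMult α s ξ) * hat u ξ‖ₑ ^ 2 =
      ENNReal.ofReal ((2 * Real.pi) ^ (2 * α)) * fourierEnergy α u := by
  rw [fourierEnergy, ← lintegral_const_mul' _ _ ENNReal.ofReal_ne_top]
  refine lintegral_congr fun ξ => ?_
  rw [enorm_mul, mul_pow, ← mul_assoc, ← ENNReal.ofReal_mul (by positivity),
    ← Real.mul_rpow (by positivity) (abs_nonneg _), ← ofReal_norm, RCLike.norm_conj,
    norm_fracMult h0, ← ENNReal.ofReal_pow (by positivity), ← Real.rpow_mul_natCast (by positivity)]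
  push_cast
  rw [mul_comm α]

theorem pow_two_lt_top_iff {a : ℝ≥0∞} : a ^ 2 < ⊤ ↔ a < ⊤ := by
  simp [ENNReal.pow_lt_top_iff]

theorem exists_isWeakFracDeriv {α : ℝ} (h0 : 0 < α) (h1 : α < 1) (s : Side) {u : L2}
    (hu : fourierEnergy α u < ⊤) : ∃ v : L2, IsWeakFracDeriv s α u v := by
  have hg : MemLp (fun ξ => conj (fracMult α s.opp ξ) * hat u ξ) 2 := by
    refine ⟨((Complex.continuous_conj.measurable.comp
      (measurable_fracMult α s.opp)).aestronglyMeasurable).mul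
      (Lp.aestronglyMeasurable (hat u)), ?_⟩
    rw [← pow_two_lt_top_iff, eLpNorm_two_sq, lintegral_enorm_sq_fracMult_mul h0]
    exact ENNReal.mul_lt_top ENNReal.ofReal_lt_top hu
  set V : Lp ℂ 2 (volume : Measure ℝ) := 𝓕⁻ (hg.toLp _) with hV
  have hFV : ∀ᵐ ξ, (𝓕 V : Lp ℂ 2 (volume : Measure ℝ)) ξ =
      conj (fracMult α s.opp ξ) * hat u ξ := by
    rw [hV, FourierTransform.fourier_fourierInv_eq]
    exact hg.coeFn_toLp
  -- Taking the real part avoids proving that `V` is real: test functions and the right-hand pairing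
  -- are real, so the identity survives.
  refine ⟨Complex.reCLM.compLp V, (Lp.memLp _).locallyIntegrable (by norm_num), fun φ hφ => ?_⟩
  have hpair : ∫ x, hφ.toSchwartz x * conj (V x) =
      ((∫ x, u x * classicalDeriv α φ s.opp x : ℝ) : ℂ) := by
    rw [integral_schwartz_mul_conj, integral_mul_classicalDeriv h0 h1 u hφ]
    refine integral_congr_ae ?_
    filter_upwards [hFV] with ξ hξ
    rw [hξ, map_mul, Complex.conj_conj]
    ring
  have hint : Integrable fun x => hφ.toSchwartz x * conj (V x) :=
    (hφ.toSchwartz.memLp 2).integrable_mul (Lp.memLp V).star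
  have hre := congrArg Complex.re hpair
  rw [Complex.ofReal_re] at hre
  rw [← hre]
  refine Eq.trans ?_ (integral_re hint)
  refine integral_congr_ae ?_
  filter_upwards [Complex.reCLM.coeFn_compLp V] with x hx
  rw [hx]
  simp [mul_comm]

theorem IsWeakFracDeriv.congr_ae {s : Side} {α : ℝ} {u v w : ℝ → ℝ} (h : IsWeakFracDeriv s α u v)
    (hvw : v =ᵐ[volume] w) : IsWeakFracDeriv s α u w := by
  refine ⟨h.1.congr hvw, fun φ hφ => ?_⟩
  rw [← h.2 φ hφ]
  exact integral_congr_ae (hvw.mono fun x hx => by simp only [hx])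

theorem isWeakFracDeriv_weakFracDeriv {s : Side} {α : ℝ} {u v : ℝ → ℝ}
    (h : IsWeakFracDeriv s α u v) : IsWeakFracDeriv s α u (weakFracDeriv s α u) := by
  have hex : ∃ v, IsWeakFracDeriv s α u v := ⟨v, h⟩
  rw [weakFracDeriv, dif_pos hex]
  exact hex.choose_spec

theorem oneSidedSeminorm_sq {α : ℝ} (h0 : 0 < α) (h1 : α < 1) {s : Side} {u : L2}
    (hu : u ∈ oneSidedH s α) : oneSidedSeminorm s α u ^ 2 =
      ENNReal.ofReal ((2 * Real.pi) ^ (2 * α)) * fourierEnergy α u := by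
  obtain ⟨v, hv, hv2⟩ := hu
  have hcoe := hv2.coeFn_toLp
  have hw : IsWeakFracDeriv s α u (hv2.toLp v) := hv.congr_ae hcoe.symm
  have hae : ∀ᵐ x, weakFracDeriv s α u x = hv2.toLp v x :=
    (isWeakFracDeriv_weakFracDeriv hv).ae_eq hw
  rw [oneSidedSeminorm, eLpNorm_congr_ae hae, ← lintegral_enorm_sq_hat,
    ← lintegral_enorm_sq_fracMult_mul h0 s.opp]
  refine lintegral_congr_ae ?_
  filter_upwards [hw.hat_eq h0 h1] with ξ hξ using by rw [hξ]

theorem mem_oneSidedH_iff {α : ℝ} (h0 : 0 < α) (h1 : α < 1) {s : Side} {u : L2} :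
    u ∈ oneSidedH s α ↔ fourierEnergy α u < ⊤ := by
  refine ⟨fun hu => ?_, fun hu => ?_⟩
  · have h := oneSidedSeminorm_sq h0 h1 hu
    obtain ⟨v, hv, hv2⟩ := hu
    have hlt : oneSidedSeminorm s α u < ⊤ := by
      rw [oneSidedSeminorm, eLpNorm_congr_ae ((isWeakFracDeriv_weakFracDeriv hv).ae_eq hv)]
      exact hv2.2
    have h2 : oneSidedSeminorm s α u ^ 2 < ⊤ := ENNReal.pow_lt_top hlt
    rw [h] at h2
    -- The constant is positive, so infinite energy would make the seminorm infinite.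
    refine lt_top_iff_ne_top.2 fun htop => ?_
    rw [htop, ENNReal.mul_top] at h2
    · exact lt_irrefl _ h2
    · rw [Ne, ENNReal.ofReal_eq_zero, not_le]
      positivity
  · obtain ⟨v, hv⟩ := exists_isWeakFracDeriv h0 h1 s hu
    exact ⟨v, hv, Lp.memLp v⟩

theorem mem_gagliardoH_iff {α : ℝ} (h0 : 0 < α) (h1 : α < 1) {u : L2} :
    u ∈ gagliardoH α ↔ fourierEnergy α u < ⊤ := by
  have hu : Measurable u := (Lp.stronglyMeasurable u).measurable
  have hm : Measurable fun z : ℝ × ℝ => |u z.1 - u z.2| / |z.1 - z.2| ^ (1 / 2 + α) := by fun_prop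
  have hsq : eLpNorm (fun z : ℝ × ℝ => |u z.1 - u z.2| / |z.1 - z.2| ^ (1 / 2 + α)) 2 ^ 2 =
      gagliardoSeminorm α u ^ 2 := by
    rw [eLpNorm_two_sq, gagliardoSeminorm, ← ENNReal.rpow_natCast _ 2, ← ENNReal.rpow_mul,
      Measure.volume_eq_prod, lintegral_prod _ (by fun_prop)]
    norm_num
    refine lintegral_congr fun x => lintegral_congr fun y => ?_
    rw [← ofReal_norm, Real.norm_of_nonneg (by positivity), ← ENNReal.ofReal_pow (by positivity),
      div_pow, ← Real.rpow_mul_natCast (abs_nonneg _), sq_abs]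
    congr 3
    push_cast
    ring
  have hmem : u ∈ gagliardoH α ↔
      eLpNorm (fun z : ℝ × ℝ => |u z.1 - u z.2| / |z.1 - z.2| ^ (1 / 2 + α)) 2 < ⊤ :=
    ⟨fun h => h.2, fun h => ⟨hm.aestronglyMeasurable, h⟩⟩
  rw [hmem, ← pow_two_lt_top_iff, hsq, gagliardoSeminorm_sq]
  refine ⟨fun h => lt_top_iff_ne_top.2 fun htop => ?_, fun h =>
    ENNReal.mul_lt_top (gagliardoConst_ne_top h0 h1).lt_top h⟩
  rw [htop, ENNReal.mul_top (gagliardoConst_ne_zero α)] at h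
  exact lt_irrefl _ h

theorem lintegral_fourierNorm (α : ℝ) (u : L2) :
    ∫⁻ ξ : ℝ, ENNReal.ofReal ((1 + |ξ| ^ (2 * α)) * ‖hat u ξ‖ ^ 2) =
      eLpNorm u 2 volume ^ 2 + fourierEnergy α u := by
  have hhat : Measurable (hat u) := (Lp.stronglyMeasurable (hat u)).measurable
  rw [← lintegral_enorm_sq_hat, fourierEnergy, ← lintegral_add_left (by fun_prop)]
  refine lintegral_congr fun ξ => ?_
  rw [ENNReal.ofReal_mul (by positivity), ENNReal.ofReal_add zero_le_one (by positivity),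
    ENNReal.ofReal_pow (norm_nonneg _), ofReal_norm, ENNReal.ofReal_one, add_mul, one_mul]

theorem mem_fourierH_iff {α : ℝ} {u : L2} : u ∈ fourierH α ↔ fourierEnergy α u < ⊤ := by
  rw [fourierH, mem_ofPred_eq, lintegral_fourierNorm, ENNReal.add_lt_top]
  exact and_iff_right (ENNReal.pow_lt_top (Lp.memLp u).2)

theorem rpow_half_sq (a : ℝ≥0∞) : (a ^ (1 / 2 : ℝ)) ^ 2 = a := by
  rw [← ENNReal.rpow_natCast, ← ENNReal.rpow_mul]
  norm_num

/-! ### Comparison of norms and the main theorem. -/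

/-- Norms whose squares are `a + c e` with the same `a`, `e` and positive finite `c` are equivalent. -/
theorem EquivOn.of_sq_eq {X : Set L2} {N₁ N₂ : L2 → ℝ≥0∞} (a e : L2 → ℝ≥0∞) {c₁ c₂ : ℝ≥0∞}
    (h₁ : c₁ ≠ 0) (h₁' : c₁ ≠ ⊤) (h₂ : c₂ ≠ 0) (h₂' : c₂ ≠ ⊤)
    (hN₁ : ∀ u ∈ X, N₁ u ^ 2 = a u + c₁ * e u) (hN₂ : ∀ u ∈ X, N₂ u ^ 2 = a u + c₂ * e u) :
    EquivOn X N₁ N₂ := by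
  -- `K` exceeds both ratios of the constants, and `1` so that the common term `a` is also
  -- controlled; the norms then compare with factor `√K`.
  set K : ℝ≥0∞ := 1 + c₁ / c₂ + c₂ / c₁ with hK
  have hKtop : K ≠ ⊤ := by
    simp [hK, ENNReal.div_eq_top, h₁, h₁', h₂, h₂']
  have hK1 : 1 ≤ K := by rw [hK, add_assoc]; exact le_self_add
  have hk₁ : c₁ ≤ K * c₂ := calc
    c₁ = c₁ / c₂ * c₂ := (ENNReal.div_mul_cancel h₂ h₂').symm
    _ ≤ K * c₂ := by gcongr; exact le_trans le_add_self le_self_add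
  have hk₂ : c₂ ≤ K * c₁ := calc
    c₂ = c₂ / c₁ * c₁ := (ENNReal.div_mul_cancel h₁ h₁').symm
    _ ≤ K * c₁ := by gcongr; exact le_add_self
  have hKr : 0 < K.toReal := ENNReal.toReal_pos (one_pos.trans_le hK1).ne' hKtop
  have key : ∀ {x y A E c d : ℝ≥0∞}, x ^ 2 = A + c * E → y ^ 2 = A + d * E → c ≤ K * d →
      x ≤ ENNReal.ofReal √K.toReal * y := fun {x y A E c d} hx hy hcd => by
    rw [← ENNReal.pow_le_pow_left_iff two_ne_zero, mul_pow, ← ENNReal.ofReal_pow (Real.sqrt_nonneg _),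
      Real.sq_sqrt hKr.le, ENNReal.ofReal_toReal hKtop, hx, hy, mul_add, ← mul_assoc]
    gcongr
    exact le_mul_of_one_le_left' hK1
  exact ⟨√K.toReal, Real.sqrt_pos.2 hKr, fun u hu =>
    ⟨key (hN₁ u hu) (hN₂ u hu) hk₁, key (hN₂ u hu) (hN₁ u hu) hk₂⟩⟩

end FracSobolev

end

theorem mainTheorem12 (α : ℝ) (hα₀ : 0 < α) (hα₁ : α < 1) :
    (∀ s : FracSobolev.Side, FracSobolev.oneSidedH s α = FracSobolev.gagliardoH α) ∧
    FracSobolev.gagliardoH α = FracSobolev.fourierH α ∧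
    (∀ s : FracSobolev.Side,
      FracSobolev.EquivOn (FracSobolev.gagliardoH α)
        (FracSobolev.oneSidedSeminorm s α) (FracSobolev.gagliardoSeminorm α)) ∧
    (∀ s : FracSobolev.Side,
      FracSobolev.EquivOn (FracSobolev.gagliardoH α)
        (FracSobolev.oneSidedNorm s α) (FracSobolev.gagliardoNorm α)) ∧
    FracSobolev.EquivOn (FracSobolev.gagliardoH α)
      (FracSobolev.gagliardoNorm α) (FracSobolev.fourierNorm α) := by
  have hset : ∀ s, FracSobolev.oneSidedH s α = FracSobolev.gagliardoH α := fun s =>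
    Set.ext fun u => (FracSobolev.mem_oneSidedH_iff hα₀ hα₁).trans (FracSobolev.mem_gagliardoH_iff hα₀ hα₁).symm
  have hc : ENNReal.ofReal ((2 * Real.pi) ^ (2 * α)) ≠ 0 := by
    rw [Ne, ENNReal.ofReal_eq_zero, not_le]
    positivity
  have hone : ∀ s : FracSobolev.Side, ∀ u ∈ FracSobolev.gagliardoH α,
      FracSobolev.oneSidedSeminorm s α u ^ 2 =
        ENNReal.ofReal ((2 * Real.pi) ^ (2 * α)) * FracSobolev.fourierEnergy α u := fun s u hu =>
    FracSobolev.oneSidedSeminorm_sq hα₀ hα₁ (by rwa [hset s])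
  have hg := FracSobolev.gagliardoConst_ne_zero α
  have hg' := FracSobolev.gagliardoConst_ne_top hα₀ hα₁
  refine ⟨hset, Set.ext fun u => (FracSobolev.mem_gagliardoH_iff hα₀ hα₁).trans
    FracSobolev.mem_fourierH_iff.symm, fun s => ?_, fun s => ?_, ?_⟩
  -- The seminorms have no `L²` term, so the common part is zero.
  · refine .of_sq_eq (fun _ => 0) (FracSobolev.fourierEnergy α) hc ENNReal.ofReal_ne_top hg hg'
      (fun u hu => ?_) fun u hu => ?_
    · rw [hone s u hu, zero_add]
    · rw [FracSobolev.gagliardoSeminorm_sq, zero_add]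
  · refine .of_sq_eq (fun u => MeasureTheory.eLpNorm u 2 MeasureTheory.volume ^ 2)
      (FracSobolev.fourierEnergy α) hc ENNReal.ofReal_ne_top hg hg' (fun u hu => ?_) fun u hu => ?_
    · rw [FracSobolev.oneSidedNorm, FracSobolev.rpow_half_sq, hone s u hu]
    · rw [FracSobolev.gagliardoNorm, FracSobolev.rpow_half_sq, FracSobolev.gagliardoSeminorm_sq]
  · refine .of_sq_eq (fun u => MeasureTheory.eLpNorm u 2 MeasureTheory.volume ^ 2)
      (FracSobolev.fourierEnergy α) hg hg' one_ne_zero ENNReal.one_ne_top (fun u hu => ?_)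
      fun u hu => ?_
    · rw [FracSobolev.gagliardoNorm, FracSobolev.rpow_half_sq, FracSobolev.gagliardoSeminorm_sq]
    · rw [FracSobolev.fourierNorm, FracSobolev.rpow_half_sq, FracSobolev.lintegral_fourierNorm,
        one_mul]
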